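/- Let $\Gamma$ be a finitely generated group with property (A): there are an integer $n$ and a representation $\rho\colon\Gamma\to\mathrm{SL}(n,\mathbb{C})$ such that $\mathrm{Tr}(\rho(\gamma))\neq\mathrm{Tr}(\rho(\eta))$ for every non-conjugate pair $\gamma,\eta\in\Gamma$. For conjugacy classes $c_1\ne c_2$ of $\Gamma$ let $\mathrm{Con}_\Gamma(c_1,c_2)\in\mathbb{N}\cup\{\infty\}$ be the least order of a finite group $Q$ admitting a homomorphism $\varphi\colon\Gamma\to Q$ such that $\varphi(c_1)$ and $\varphi(c_2)$ lie in different conjugacy classes of $Q$. For a finite generating set $X$ of $\Gamma$, let the length $\|c\|_X$ of a class be the minimal word length with respect to $X$ of an element of $c$, and put $$\mathrm{Conj}_{\Gamma,X}(n)=\max\{\mathrm{Con}_\Gamma(c_1,c_2) : \|c_1\|_X,\|c_2\|_X\le n,\ c_1\neq c_2\}$$ (with value $0$ if there is no such pair). Write $f\preceq g$ if there is a positive integer $C$ with $f(n)\le C\,g(Cn)$ for all $n\in\mathbb{N}$. Then there is $d\in\mathbb{N}$ such that $\mathrm{Conj}_{\Gamma,X}(n)\preceq n^d$ for every finite generating set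 $X$. Moreover, the finite quotients used can be taken to be subgroups of $\mathrm{SL}(n_0,\mathbb{F}_p)$ for a fixed $n_0$ and for $p$ in a fixed infinite set $P$ of primes, in the following sense. 1. For every finite generating set $X$ there is a positive integer $C$ such that, for all $n\in\mathbb{N}$ and all classes $c_1\ne c_2$ with $\|c_1\|_X,\|c_2\|_X\le n$, there are a prime $p\in P$, a subgroup $Q\le\mathrm{SL}(n_0,\mathbb{F}_p)$ and a surjective homomorphism $\varphi\colon\Gamma\to Q$ such that $\varphi(c_1)$ and $\varphi(c_2)$ lie in different conjugacy classes of $Q$ and $|Q|\le C(Cn)^d$. 2. For any two conjugacy classes $c_1\neq c_2$ of $\Gamma$ and for all but finitely many $p\in P$, there are a subgroup $Q\le\mathrm{SL}(n_0,\mathbb{F}_p)$ and a surjective homomorphism $\varphi\colon\Gamma\to Q$ such that $\varphi(c_1)$ and $\varphi(c_2)$ lie in different conjugacy classes of $Q$. -/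

import Mathlib

open scoped MatrixGroups

namespace ConjSep

/-- Some representation `ρ : Γ → SL(n, ℂ)` distinguishes all pairs of non-conjugate elements of `Γ`
by the traces of their images. -/
def PropertyA (Γ : Type*) [Group Γ] : Prop :=
  ∃ (n : ℕ) (ρ : Γ →* SL(n, ℂ)), ∀ γ η : Γ, ¬ IsConj γ η →
    (ρ γ : Matrix (Fin n) (Fin n) ℂ).trace ≠ (ρ η : Matrix (Fin n) (Fin n) ℂ).trace

/-- `X` is a finite generating set of `Γ`. -/
def IsFiniteGeneratingSet {Γ : Type*} [Group Γ] (X : Set Γ) : Prop :=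
  X.Finite ∧ Subgroup.closure X = ⊤

/-- The word length of `γ` with respect to `X`: the least length of a word in the letters
`X ∪ X⁻¹` that represents `γ` (meaningful when `X` generates). -/
noncomputable def wordLength {Γ : Type*} [Group Γ] (X : Set Γ) (γ : Γ) : ℕ :=
  sInf {k : ℕ | ∃ w : List Γ, (∀ x ∈ w, x ∈ X ∨ x⁻¹ ∈ X) ∧ w.prod = γ ∧ w.length = k}

/-- The length of a conjugacy class: the least word length of one of its elements. -/
noncomputable def classLength {Γ : Type*} [Group Γ] (X : Set Γ) (c : ConjClasses Γ) : ℕ :=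
  sInf (wordLength X '' c.carrier)

/-- The ball `B_X(C_Γ, n)` of conjugacy classes of length at most `n`. -/
def classBall {Γ : Type*} [Group Γ] (X : Set Γ) (n : ℕ) : Set (ConjClasses Γ) :=
  {c | classLength X c ≤ n}

/-- The homomorphism `φ : Γ → Q` sends the classes `c₁`, `c₂` of `Γ` to distinct conjugacy classes
of `Q`. -/
def Separates {Γ Q : Type*} [Group Γ] [Group Q] (φ : Γ →* Q) (c₁ c₂ : ConjClasses Γ) : Prop :=
  ConjClasses.map φ c₁ ≠ ConjClasses.map φ c₂

/-- `Con_Γ(c₁, c₂)`: the least order of a finite group `Q` with a homomorphism `Γ → Q` under which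
the images of `c₁` and `c₂` are not conjugate in `Q`; it is `⊤` if there is none. (Every finite
group is isomorphic to one in `Type`.) -/
noncomputable def con {Γ : Type*} [Group Γ] (c₁ c₂ : ConjClasses Γ) : ℕ∞ :=
  sInf {k : ℕ∞ | ∃ (Q : Type) (_ : Group Q) (_ : Finite Q) (φ : Γ →* Q),
    Separates φ c₁ c₂ ∧ k = (Nat.card Q : ℕ∞)}

/-- The conjugacy separability complexity function `Conj_{Γ,X}`. -/
noncomputable def conjComplexity {Γ : Type*} [Group Γ] (X : Set Γ) (n : ℕ) : ℕ∞ :=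
  sSup {k : ℕ∞ | ∃ c₁ ∈ classBall X n, ∃ c₂ ∈ classBall X n, c₁ ≠ c₂ ∧ k = con c₁ c₂}

/-- The relation `f ≼ g`: there is a positive integer `C` with `f n ≤ C * g (C * n)` for all `n`. -/
def AsympLE (f g : ℕ → ℕ∞) : Prop :=
  ∃ C : ℕ, 0 < C ∧ ∀ n : ℕ, f n ≤ (C : ℕ∞) * g (C * n)

end ConjSep

/-! The traces of ρ separate classes, but lie in ℂ. As ℂ is algebraic over ℤ[s], with s a
transcendence basis, and Γ is finitely generated, restriction of scalars gives ψ : Γ → SL(nm,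
ℤ[s][1/g]). Its ordinary trace may lose information; the sum of its diagonal m × m blocks is the
matrix of multiplication by Tr ρ, so it still determines the class in Γ (`exists_blockTrace_model`).
An integer point a with p ∤ g(a) gives a map ℤ[s][1/g] → 𝔽_p without residue field extensions, so P
can be the set of all primes.

Block traces are not conjugation invariant in SL(nm, 𝔽_p). But Q is the image of Γ, so conjugators
in Q lift to Γ, where invariance holds before reduction (`exists_separates_of_blockTrace`).

For words of length N, clearing denominators in a difference of block traces gives a nonzero
polynomial of degree O(N), with values 2^{O(N²)} on a box of size O(N). Some value there is nonzero,
a prime p = O(N⁴) does not divide it, and |Q| ≤ p^{(nm)²}. -/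

/-- A homomorphism lifts along an injective one as soon as a generating set does. -/
lemma MonoidHom.exists_lift_of_closure_eq_top {Γ H H' : Type*} [Group Γ] [Group H] [Group H']
    (i : H' →* H) (hi : Function.Injective i) (f : Γ →* H) {S : Set Γ}
    (hS : Subgroup.closure S = ⊤) (h : ∀ s ∈ S, f s ∈ i.range) :
    ∃ f' : Γ →* H', i.comp f' = f := by
  have hf : ∀ x, f x ∈ i.range := fun x => by
    have : Subgroup.closure S ≤ i.range.comap f := (Subgroup.closure_le _).2 h
    exact this (hS ▸ Subgroup.mem_top x)
  refine ⟨(MonoidHom.ofInjective hi).symm.toMonoidHom.comp (f.codRestrict i.range hf), ?_⟩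
  ext x
  have := (MonoidHom.ofInjective hi).apply_symm_apply (f.codRestrict i.range hf x)
  exact congrArg Subtype.val this

/-! ### Block traces and restriction of scalars -/

namespace Matrix

lemma SpecialLinearGroup.map_injective {n R R' : Type*} [Fintype n] [DecidableEq n] [CommRing R]
    [CommRing R'] {j : R' →+* R} (hj : Function.Injective j) :
    Function.Injective (SpecialLinearGroup.map (n := n) j) := by
  intro A B h
  ext a b
  exact hj (congrFun (congrFun (congrArg Subtype.val h) a) b)

lemma SpecialLinearGroup.mem_range_map {n R R' : Type*} [Fintype n] [DecidableEq n] [CommRing R]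
    [CommRing R'] {j : R' →+* R} (hj : Function.Injective j) (A : SpecialLinearGroup n R)
    (h : ∀ a b, A.1 a b ∈ j.range) : A ∈ (SpecialLinearGroup.map (n := n) j).range := by
  choose B hB using h
  have hBA : j.mapMatrix (Matrix.of B) = A.1 := by
    ext a b
    exact hB a b
  have hdet : (Matrix.of B).det = 1 := by
    apply hj
    rw [RingHom.map_det, hBA, A.2, map_one]
  exact ⟨⟨Matrix.of B, hdet⟩, Subtype.ext hBA⟩

/-- The sum of the diagonal blocks. -/
def blockTrace {n m R : Type*} [Fintype n] [AddCommMonoid R] (M : Matrix (n × m) (n × m) R) :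
    Matrix m m R :=
  trace ((comp n n m m R).symm M)

lemma blockTrace_apply {n m R : Type*} [Fintype n] [AddCommMonoid R]
    (M : Matrix (n × m) (n × m) R) (j k : m) : blockTrace M j k = ∑ i, M (i, j) (i, k) := by
  simp [blockTrace, trace, Matrix.sum_apply]

lemma blockTrace_map {n m R R' : Type*} [Fintype n] [Semiring R] [Semiring R'] (θ : R →+* R')
    (M : Matrix (n × m) (n × m) R) : blockTrace (M.map θ) = (blockTrace M).map θ := by
  ext j k
  simp [blockTrace_apply]

/-- Replacing the entries of a matrix of determinant one by blocks, along a ring homomorphism to a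
matrix ring. -/
noncomputable def SpecialLinearGroup.toBlocks {n m R S : Type*} [Fintype n] [DecidableEq n]
    [Fintype m] [DecidableEq m] [CommRing R] [CommRing S] (f : S →+* Matrix m m R) :
    SpecialLinearGroup n S →* SpecialLinearGroup (n × m) R where
  toFun A := ⟨comp n n m m R (A.1.map f), by rw [← Matrix.det_det, A.2, map_one, det_one]⟩
  map_one' := Subtype.ext <| by
    change compRingEquiv n m R (f.mapMatrix 1) = 1
    rw [map_one, map_one]
  map_mul' A B := Subtype.ext <| by
    change compRingEquiv n m R (f.mapMatrix (A.1 * B.1)) =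
      compRingEquiv n m R (f.mapMatrix A.1) * compRingEquiv n m R (f.mapMatrix B.1)
    rw [map_mul, map_mul]

lemma SpecialLinearGroup.blockTrace_toBlocks {n m R S : Type*} [Fintype n] [DecidableEq n]
    [Fintype m] [DecidableEq m] [CommRing R] [CommRing S] (f : S →+* Matrix m m R)
    (A : SpecialLinearGroup n S) : blockTrace (toBlocks f A).1 = f A.1.trace := by
  rw [blockTrace, AddMonoidHom.map_trace]
  rfl

end Matrix

open Matrix

/-- A representation over a field that is algebraic over a domain `R` becomes, by restriction of
scalars, a representation over a localization of `R` at one element. The trace becomes the block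
trace. -/
lemma exists_blockTrace_model {Γ R K : Type*} [Group Γ] [Group.FG Γ] [CommRing R] [IsDomain R]
    [Field K] [Algebra R K] [FaithfulSMul R K] [Algebra.IsAlgebraic R K] {n : ℕ}
    (ρ : Γ →* SL(n, K)) :
    ∃ (m : ℕ) (g : R) (ψ : Γ →* SpecialLinearGroup (Fin n × Fin m) (Localization.Away g)),
      g ≠ 0 ∧ ∀ γ η : Γ, blockTrace (ψ γ).1 = blockTrace (ψ η).1 ↔
        (ρ γ).1.trace = (ρ η).1.trace := by
  classical
  obtain ⟨S, hS, hSfin⟩ := Group.fg_iff.1 (inferInstance : Group.FG Γ)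
  let L := FractionRing R
  let : Algebra L K := FractionRing.liftAlgebra R K
  have : IsScalarTower R L K := FractionRing.isScalarTower_liftAlgebra R K
  have : Algebra.IsAlgebraic L K :=
    (IsFractionRing.comap_isAlgebraic_iff (A := R) (K := L) (C := K)).1 inferInstance
  have hSf : Finite S := hSfin
  let E : Set K := Set.range fun x : S × Fin n × Fin n => (ρ x.1).1 x.2.1 x.2.2
  have hE : E.Finite := Set.finite_range _
  let K' := IntermediateField.adjoin L E
  have : Finite E := hE
  have : FiniteDimensional L K' := IntermediateField.finiteDimensional_adjoin
    fun x _ => (Algebra.IsAlgebraic.isAlgebraic x).isIntegral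
  obtain ⟨ρ', hρ'⟩ := MonoidHom.exists_lift_of_closure_eq_top
    (SpecialLinearGroup.map (n := Fin n) (algebraMap K' K))
    (SpecialLinearGroup.map_injective (algebraMap K' K).injective) ρ hS (fun s hs =>
      SpecialLinearGroup.mem_range_map (algebraMap K' K).injective _ fun a b =>
        ⟨⟨_, IntermediateField.subset_adjoin L E ⟨⟨⟨s, hs⟩, a, b⟩, rfl⟩⟩, rfl⟩)
  let b := Module.finBasis L K'
  let f : K' →+* Matrix (Fin (Module.finrank L K')) (Fin (Module.finrank L K')) L :=
    (Algebra.leftMulMatrix b).toRingHom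
  have hf : Function.Injective f := Algebra.leftMulMatrix_injective b
  let σ := (SpecialLinearGroup.toBlocks (n := Fin n) f).comp ρ'
  -- One denominator serves all generators; their inverses need none, having determinant one.
  obtain ⟨g, hg⟩ := IsLocalization.exist_integer_multiples_of_finite (nonZeroDivisors R)
    (fun x : S × (Fin n × Fin (Module.finrank L K')) × (Fin n × Fin (Module.finrank L K')) =>
      (σ x.1).1 x.2.1 x.2.2)
  have hg0 : (g : R) ≠ 0 := nonZeroDivisors.coe_ne_zero g
  have hgL : algebraMap R L g ≠ 0 :=
    (map_ne_zero_iff _ (IsFractionRing.injective R L)).2 hg0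
  let j : Localization.Away (g : R) →+* L :=
    IsLocalization.Away.lift (g : R) (g := algebraMap R L) hgL.isUnit
  have hjR : ∀ x, j (algebraMap R _ x) = algebraMap R L x := fun x =>
    IsLocalization.Away.lift_eq _ _ _
  have hj : Function.Injective j := by
    refine (IsLocalization.lift_injective_iff _).2 fun x y => ?_
    rw [(IsFractionRing.injective R L).eq_iff, (IsLocalization.injective (Localization.Away (g : R))
      (powers_le_nonZeroDivisors_of_noZeroDivisors hg0)).eq_iff]
  obtain ⟨ψ, hψ⟩ := MonoidHom.exists_lift_of_closure_eq_top
    (SpecialLinearGroup.map (n := Fin n × Fin (Module.finrank L K')) j)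
    (SpecialLinearGroup.map_injective hj) σ hS (fun s hs =>
      SpecialLinearGroup.mem_range_map hj _ fun a c => by
        obtain ⟨y, hy⟩ := hg ⟨⟨s, hs⟩, a, c⟩
        refine ⟨algebraMap R _ y * IsLocalization.Away.invSelf (g : R), ?_⟩
        have h1 : j (IsLocalization.Away.invSelf (g : R)) * algebraMap R L g = 1 := by
          rw [← hjR, ← map_mul, mul_comm, IsLocalization.Away.mul_invSelf, map_one]
        rw [map_mul, hjR, hy, Algebra.smul_def]
        linear_combination ((σ s).1 a c) * h1)
  refine ⟨_, g, ψ, hg0, fun γ η => ?_⟩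
  have key : ∀ γ, (blockTrace (ψ γ).1).map j = f (ρ' γ).1.trace := fun γ => by
    rw [← blockTrace_map, ← SpecialLinearGroup.blockTrace_toBlocks]
    exact congrArg blockTrace (congrArg Subtype.val (DFunLike.congr_fun hψ γ))
  have key2 : ∀ γ, algebraMap K' K (ρ' γ).1.trace = (ρ γ).1.trace := fun γ => by
    rw [← hρ']
    exact AddMonoidHom.map_trace (algebraMap K' K) _
  rw [← (Matrix.map_injective hj).eq_iff, key, key, hf.eq_iff, ← key2, ← key2,
    (algebraMap K' K).injective.eq_iff]

/-- A field of characteristic zero is algebraic over a polynomial ring with integer coefficients. -/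
lemma exists_isAlgebraic_mvPolynomial_int (K : Type*) [Field K] [CharZero K] :
    ∃ (s : Set K) (_ : Algebra (MvPolynomial s ℤ) K),
      FaithfulSMul (MvPolynomial s ℤ) K ∧ Algebra.IsAlgebraic (MvPolynomial s ℤ) K := by
  obtain ⟨s, hs⟩ := exists_isTranscendenceBasis ℤ K
  let : Algebra (MvPolynomial s ℤ) K :=
    (MvPolynomial.aeval (R := ℤ) ((↑) : s → K)).toRingHom.toAlgebra
  have hinj : Function.Injective (algebraMap (MvPolynomial s ℤ) K) := hs.1
  have : FaithfulSMul (MvPolynomial s ℤ) K := (faithfulSMul_iff_algebraMap_injective _ _).2 hinj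
  refine ⟨s, inferInstance, inferInstance, ⟨fun x => ?_⟩⟩
  obtain ⟨p, hp, hpx⟩ := hs.isAlgebraic.isAlgebraic x
  -- Algebraicity is known over the subalgebra generated by `s`; `e` carries the coefficients to
  -- polynomials.
  let e := hs.1.aevalEquiv
  refine ⟨p.map (e.symm : _ →+* MvPolynomial s ℤ), ?_, ?_⟩
  · exact (Polynomial.map_ne_zero_iff e.symm.injective).2 hp
  · rw [Polynomial.aeval_def, Polynomial.eval₂_map]
    rw [Polynomial.aeval_def] at hpx
    convert hpx
    ext a
    obtain ⟨y, rfl⟩ := e.surjective a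
    simp [e]
    rfl

/-! ### Small primes not dividing an integer -/

/-- Chebyshev's bound, weakened by log K ≤ K to avoid logarithms; any polynomial bound suffices. -/
lemma four_mul_primeCounting_sq_ge {K : ℕ} (hK : 2 ≤ K) :
    K ≤ 4 * (Nat.primeCounting (K ^ 2) + 2) := by
  have h1 := Chebyshev.psi_ge (K ^ 2)
  have h2 := Chebyshev.psi_le_primeCounting_mul_log (K ^ 2)
  have hK' : (2 : ℝ) ≤ K := by exact_mod_cast hK
  have hlog0 : 0 ≤ Real.log K := Real.log_nonneg (by linarith)
  have hlog : Real.log K ≤ K := Real.log_le_self (by linarith)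
  have h3 : Real.log ((K : ℝ) ^ 2 + 1) ≤ 2 * (2 * Real.log K) := by
    have : Real.log ((K : ℝ) ^ 2 + 1) ≤ Real.log ((K : ℝ) ^ 4) :=
      Real.log_le_log (by positivity) (by nlinarith [sq_nonneg ((K : ℝ) ^ 2 - 1)])
    rw [Real.log_pow] at this
    push_cast at this
    linarith
  push_cast at h1 h2
  rw [Real.log_pow] at h2
  push_cast at h2
  have h4 := Real.log_two_gt_d9
  set π : ℝ := (Nat.primeCounting (K ^ 2) : ℝ) with hπ
  have hπ0 : 0 ≤ π := Nat.cast_nonneg _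
  have h5 : (K : ℝ) ^ 2 * (1 / 2) ≤ (π + 2) * (2 * K) := by
    have h6 : (π + 2) * (2 * Real.log K) ≤ (π + 2) * (2 * K) := by gcongr
    nlinarith [sq_nonneg (K : ℝ)]
  have h7 : (K : ℝ) ≤ 4 * (π + 2) := by
    have : (K : ℝ) * K ≤ K * (4 * (π + 2)) := by nlinarith
    exact le_of_mul_le_mul_left this (by linarith)
  rw [hπ] at h7
  exact_mod_cast h7

/-- A nonzero integer of at most `M` binary digits is prime to a prime of size `O(M²)`. -/
lemma Nat.exists_prime_le_not_dvd {T M : ℕ} (hT : T ≠ 0) (hTM : T ≤ 2 ^ M) :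
    ∃ p, p.Prime ∧ p ≤ (4 * (M + 4)) ^ 2 ∧ ¬ p ∣ T := by
  by_contra! h
  have hsub : Nat.primesLE ((4 * (M + 4)) ^ 2) ⊆ T.primeFactors := fun p hp => by
    rw [Nat.mem_primesLE] at hp
    exact Nat.mem_primeFactors.2 ⟨hp.2, h p hp.2 hp.1, hT⟩
  have hcard := Finset.card_le_card hsub
  rw [Nat.primesLE_card_eq_primeCounting] at hcard
  have h1 : 2 ^ T.primeFactors.card ≤ T :=
    (Finset.pow_card_le_prod _ _ _ fun p hp =>
      (Nat.prime_of_mem_primeFactors hp).two_le).trans (Nat.le_of_dvd (Nat.pos_of_ne_zero hT) (Nat.prod_primeFactors_dvd T))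
  have h2 : T.primeFactors.card ≤ M := (Nat.pow_le_pow_iff_right (by norm_num)).1 (h1.trans hTM)
  -- This gives at least M + 2 primes, while T has at most M prime factors.
  have h3 := four_mul_primeCounting_sq_ge (K := 4 * (M + 4)) (by omega)
  omega

/-! ### Degrees and values of integral polynomials -/

namespace MvPolynomial

/-- A nonzero integral polynomial has a nonzero value in a box as large as its degree. -/
lemma exists_abs_le_eval_ne_zero {ι : Type*} {q : MvPolynomial ι ℤ} (hq : q ≠ 0) {B : ℕ}
    (hB : q.totalDegree ≤ B) : ∃ a : ι → ℤ, (∀ t, |a t| ≤ B) ∧ eval a q ≠ 0 := by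
  classical
  obtain ⟨s, r, rfl⟩ := exists_finset_rename q
  have hr : r ≠ 0 := by rintro rfl; simp at hq
  by_contra! h
  refine hr (eq_zero_of_eval_zero_at_prod_finset r (fun _ => Finset.Icc 0 (B : ℤ)) (fun i => ?_)
    fun x hx => ?_)
  · rw [← degreeOf_rename_of_injective Subtype.val_injective i, Int.card_Icc]
    have := (degreeOf_le_totalDegree (rename ((↑) : s → ι) r) i).trans hB
    omega
  · have := h (fun t => if ht : t ∈ s then x ⟨t, ht⟩ else 0) fun t => by
      split_ifs with ht
      · have := Finset.mem_Icc.1 (hx ⟨t, ht⟩)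
        rw [abs_of_nonneg this.1]
        exact this.2
      · simp
    rw [eval_rename] at this
    have hx' : x = (fun t => if ht : t ∈ s then x ⟨t, ht⟩ else 0) ∘ ((↑) : s → ι) := by
      ext t
      simp
    rw [hx']
    exact this

/-- The degree of `q` is at most `c`, and its values on the box of size `B` are at most
`2 ^ (c * B)`. -/
structure ExpBounded {ι : Type*} (c : ℕ) (q : MvPolynomial ι ℤ) : Prop where
  totalDegree_le : q.totalDegree ≤ c
  abs_eval_le : ∀ B : ℕ, 1 ≤ B → ∀ a : ι → ℤ, (∀ t, |a t| ≤ B) → |eval a q| ≤ 2 ^ (c * B)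

namespace ExpBounded

variable {ι : Type*} {c c' : ℕ} {q q' : MvPolynomial ι ℤ}

lemma mono (h : ExpBounded c q) (hc : c ≤ c') : ExpBounded c' q where
  totalDegree_le := h.1.trans hc
  abs_eval_le B hB a ha := (h.2 B hB a ha).trans <|
    pow_le_pow_right₀ (by norm_num) (Nat.mul_le_mul_right _ hc)

lemma mul (h : ExpBounded c q) (h' : ExpBounded c' q') : ExpBounded (c + c') (q * q') where
  totalDegree_le := (totalDegree_mul _ _).trans (add_le_add h.1 h'.1)
  abs_eval_le B hB a ha := by
    rw [map_mul, abs_mul, add_mul, pow_add]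
    exact mul_le_mul (h.2 B hB a ha) (h'.2 B hB a ha) (abs_nonneg _) (by positivity)

/-- The number of terms is absorbed into the exponent, which needs B ≥ 1. -/
lemma sum {κ : Type*} (s : Finset κ) {f : κ → MvPolynomial ι ℤ}
    (h : ∀ i ∈ s, ExpBounded c (f i)) : ExpBounded (s.card + c) (∑ i ∈ s, f i) where
  totalDegree_le := (totalDegree_finsetSum_le fun i hi => (h i hi).1).trans (Nat.le_add_left _ _)
  abs_eval_le B hB a ha := by
    rw [map_sum]
    calc |∑ i ∈ s, eval a (f i)| ≤ ∑ i ∈ s, |eval a (f i)| := Finset.abs_sum_le_sum_abs _ _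
      _ ≤ ∑ i ∈ s, 2 ^ (c * B) := Finset.sum_le_sum fun i hi => (h i hi).2 B hB a ha
      _ = s.card * 2 ^ (c * B) := by simp
      _ ≤ 2 ^ (s.card * B) * 2 ^ (c * B) := by
        gcongr
        calc (s.card : ℤ) ≤ 2 ^ s.card := by exact_mod_cast Nat.lt_two_pow_self.le
          _ ≤ 2 ^ (s.card * B) := pow_le_pow_right₀ (by norm_num) (Nat.le_mul_of_pos_right _ hB)
      _ = 2 ^ ((s.card + c) * B) := by rw [add_mul, pow_add]

lemma neg (h : ExpBounded c q) : ExpBounded c (-q) where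
  totalDegree_le := (totalDegree_neg q).trans_le h.1
  abs_eval_le B hB a ha := by rw [map_neg, abs_neg]; exact h.2 B hB a ha

lemma add (h : ExpBounded c q) (h' : ExpBounded c q') : ExpBounded (2 + c) (q + q') := by
  simpa using sum Finset.univ (f := ![q, q']) (c := c) (by simp [h, h'])

lemma const (k : ℤ) : ExpBounded (ι := ι) k.natAbs (C k) where
  totalDegree_le := by rw [totalDegree_C]; exact Nat.zero_le _
  abs_eval_le B hB a ha := by
    rw [eval_C, Int.abs_eq_natAbs]
    calc (k.natAbs : ℤ) ≤ 2 ^ k.natAbs := by exact_mod_cast Nat.lt_two_pow_self.le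
      _ ≤ 2 ^ (k.natAbs * B) := pow_le_pow_right₀ (by norm_num) (Nat.le_mul_of_pos_right _ hB)

lemma variable_self (t : ι) : ExpBounded 1 (X t : MvPolynomial ι ℤ) where
  totalDegree_le := (totalDegree_X t).le
  abs_eval_le B hB a ha := by
    rw [eval_X, one_mul]
    exact (ha t).trans (by exact_mod_cast Nat.lt_two_pow_self.le)

end ExpBounded

lemma exists_expBounded {ι : Type*} (q : MvPolynomial ι ℤ) : ∃ c, ExpBounded c q := by
  induction q using induction_on with
  | C k => exact ⟨_, .const k⟩
  | add p q hp hq =>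
    obtain ⟨c, hc⟩ := hp
    obtain ⟨c', hc'⟩ := hq
    exact ⟨_, (hc.mono (le_max_left c c')).add (hc'.mono (le_max_right c c'))⟩
  | mul_X p t hp =>
    obtain ⟨c, hc⟩ := hp
    exact ⟨_, hc.mul (.variable_self t)⟩

lemma exists_forall_expBounded {ι κ : Type*} [Finite κ] (q : κ → MvPolynomial ι ℤ) :
    ∃ c, ∀ k, ExpBounded c (q k) := by
  cases nonempty_fintype κ
  choose c hc using fun k => exists_expBounded (q k)
  exact ⟨∑ k, c k, fun k => (hc k).mono (Finset.single_le_sum (by simp) (Finset.mem_univ k))⟩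

/-- Each factor adds a constant to the exponent, so growth is linear in the word length. -/
lemma ExpBounded.list_prod {ι κ : Type*} [Fintype κ] [DecidableEq κ] {c : ℕ}
    (l : List (Matrix κ κ (MvPolynomial ι ℤ))) (h : ∀ M ∈ l, ∀ i j, ExpBounded c (M i j))
    (i j : κ) : ExpBounded (l.length * (Fintype.card κ + c)) (l.prod i j) := by
  induction l generalizing i j with
  | nil =>
    simp only [List.length_nil, zero_mul, List.prod_nil, Matrix.one_apply]
    split_ifs
    · exact ⟨by simp, by simp⟩
    · exact ⟨by simp, by simp⟩
  | cons M l ih =>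
    rw [List.prod_cons, Matrix.mul_apply]
    refine (ExpBounded.sum Finset.univ fun k _ => (h M (by simp) i k).mul
      (ih (fun N hN => h N (by simp [hN])) k j)).mono ?_
    simp only [Finset.card_univ, List.length_cons]
    linarith

end MvPolynomial

/-- Reindexing of matrices of determinant one. -/
def Matrix.SpecialLinearGroup.reindexHom {n m : Type*} (R : Type*) [Fintype n] [DecidableEq n]
    [Fintype m] [DecidableEq m] [CommRing R] (e : n ≃ m) :
    SpecialLinearGroup n R →* SpecialLinearGroup m R where
  toFun A := ⟨reindex e e A.1, by rw [det_reindex_self, A.2]⟩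
  map_one' := Subtype.ext <| (reindexRingEquiv R e).map_one
  map_mul' A B := Subtype.ext <| (reindexRingEquiv R e).map_mul A.1 B.1

lemma Matrix.SpecialLinearGroup.reindexHom_injective {n m R : Type*} [Fintype n] [DecidableEq n]
    [Fintype m] [DecidableEq m] [CommRing R] (e : n ≃ m) :
    Function.Injective (reindexHom R e) := fun _ _ h =>
  Subtype.ext ((reindex e e).injective (congrArg Subtype.val h))

lemma Matrix.SpecialLinearGroup.card_zmod_le (n p : ℕ) [NeZero p] :
    Nat.card SL(n, ZMod p) ≤ p ^ (n * n) := by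
  refine (Nat.card_le_card_of_injective (fun A : SL(n, ZMod p) => A.1)
    Subtype.val_injective).trans ?_
  change Nat.card (Fin n → Fin n → ZMod p) ≤ _
  simp [pow_mul]

/-! ### Separation of classes modulo primes -/

namespace ConjSep

lemma exists_word_of_mem_classBall {Γ : Type*} [Group Γ] {X : Set Γ}
    (hX : IsFiniteGeneratingSet X) {n : ℕ} {c : ConjClasses Γ} (hc : c ∈ classBall X n) :
    ∃ w : List Γ, (∀ x ∈ w, x ∈ X ∨ x⁻¹ ∈ X) ∧ w.length ≤ n ∧ ConjClasses.mk w.prod = c := by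
  have hne : (wordLength X '' c.carrier).Nonempty := by
    obtain ⟨γ, rfl⟩ := ConjClasses.exists_rep c
    exact ⟨_, γ, ConjClasses.mem_carrier_mk, rfl⟩
  obtain ⟨γ, hγ, hlen⟩ := Nat.sInf_mem hne
  -- Generation makes the set of lengths nonempty, so its infimum is attained and is not the default
  -- 0.
  obtain ⟨w, hw, hwγ⟩ := Submonoid.exists_list_of_mem_closure (s := X ∪ X⁻¹) (x := γ) (by
    rw [← Subgroup.closure_toSubmonoid, hX.2]
    exact Submonoid.mem_top γ)
  obtain ⟨v, hv, hvγ, hvlen⟩ := Nat.sInf_mem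
    (s := {k : ℕ | ∃ w : List Γ, (∀ x ∈ w, x ∈ X ∨ x⁻¹ ∈ X) ∧ w.prod = γ ∧ w.length = k})
    ⟨_, w, hw, hwγ, rfl⟩
  refine ⟨v, hv, ?_, ?_⟩
  · rw [hvlen]
    exact hlen.trans_le hc
  · rw [hvγ]
    exact ConjClasses.mem_carrier_iff_mk_eq.1 hγ

/-- Block traces that differ after reduction separate conjugacy classes in the image. -/
lemma exists_separates_of_blockTrace {Γ R : Type*} [Group Γ] [CommRing R] {n m p : ℕ}
    (ψ : Γ →* SpecialLinearGroup (Fin n × Fin m) R)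
    (hψ : ∀ γ η, IsConj γ η → blockTrace (ψ γ).1 = blockTrace (ψ η).1) (θ : R →+* ZMod p)
    {γ η : Γ} {j k : Fin m}
    (h : θ (blockTrace (ψ γ).1 j k) ≠ θ (blockTrace (ψ η).1 j k)) :
    ∃ (Q : Subgroup SL(n * m, ZMod p)) (φ : Γ →* Q),
      Function.Surjective φ ∧ Separates φ (ConjClasses.mk γ) (ConjClasses.mk η) := by
  let φ : Γ →* SL(n * m, ZMod p) := (SpecialLinearGroup.reindexHom (ZMod p) finProdFinEquiv).comp
    ((SpecialLinearGroup.map θ).comp ψ)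
  refine ⟨φ.range, φ.rangeRestrict, φ.rangeRestrict_surjective, fun hc => h ?_⟩
  obtain ⟨⟨_, δ, rfl⟩, hδ⟩ := isConj_iff.1 (ConjClasses.mk_eq_mk_iff_isConj.1 hc)
  have h1 : φ (δ * γ * δ⁻¹) = φ η := by
    simpa using congrArg Subtype.val hδ
  have h2 : (ψ (δ * γ * δ⁻¹)).1.map θ = (ψ η).1.map θ :=
    congrArg Subtype.val (SpecialLinearGroup.reindexHom_injective finProdFinEquiv h1)
  rw [hψ γ (δ * γ * δ⁻¹) (isConj_iff.2 ⟨δ, rfl⟩)]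
  have h3 := congrArg blockTrace h2
  rw [blockTrace_map, blockTrace_map] at h3
  exact congrFun (congrFun h3 j) k

/-- Evaluation at an integer point modulo `p`, on the polynomials with `g` inverted. -/
lemma exists_away_eval_mod {ι : Type*} {g : MvPolynomial ι ℤ} {p : ℕ} (hp : p.Prime) (a : ι → ℤ)
    (h : ¬ (p : ℤ) ∣ MvPolynomial.eval a g) :
    ∃ θ : Localization.Away g →+* ZMod p,
      ∀ q, θ (algebraMap _ _ q) = (MvPolynomial.eval a q : ℤ) := by
  have := Fact.mk hp
  have hu : IsUnit (((Int.castRingHom (ZMod p)).comp (MvPolynomial.eval a)) g) := by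
    rw [isUnit_iff_ne_zero]
    exact fun h0 => h ((ZMod.intCast_zmod_eq_zero_iff_dvd _ _).1 h0)
  exact ⟨IsLocalization.Away.lift g hu, fun q => IsLocalization.Away.lift_eq _ _ _⟩

/-- The factor g makes evaluation extend to the localization; the factor h detects the difference of
block traces. -/
lemma exists_separates_of_not_dvd_eval {Γ ι : Type*} [Group Γ] {n m p : ℕ}
    {g : MvPolynomial ι ℤ} (ψ : Γ →* SpecialLinearGroup (Fin n × Fin m) (Localization.Away g))
    (hψ : ∀ γ η, IsConj γ η → blockTrace (ψ γ).1 = blockTrace (ψ η).1)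
    {γ η : Γ} {j k : Fin m} {h : MvPolynomial ι ℤ} {b : Localization.Away g}
    (hh : algebraMap _ _ h = b * (blockTrace (ψ γ).1 j k - blockTrace (ψ η).1 j k))
    (hp : p.Prime) (a : ι → ℤ) (hpa : ¬ (p : ℤ) ∣ MvPolynomial.eval a (h * g)) :
    ∃ (Q : Subgroup SL(n * m, ZMod p)) (φ : Γ →* Q),
      Function.Surjective φ ∧ Separates φ (ConjClasses.mk γ) (ConjClasses.mk η) := by
  rw [map_mul] at hpa
  obtain ⟨θ, hθ⟩ := exists_away_eval_mod hp a fun hd => hpa (hd.mul_left _)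
  refine exists_separates_of_blockTrace ψ hψ θ (j := j) (k := k) fun heq => hpa ?_
  refine Dvd.dvd.mul_right ((ZMod.intCast_zmod_eq_zero_iff_dvd _ _).1 ?_) _
  rw [← hθ, hh, map_mul, map_sub, heq, sub_self, mul_zero]

section Model

variable {Γ ι : Type*} [Group Γ] {n m : ℕ} {g : MvPolynomial ι ℤ}
  {ψ : Γ →* SpecialLinearGroup (Fin n × Fin m) (Localization.Away g)}

lemma exists_blockTrace_apply_ne
    (hψ : ∀ γ η, blockTrace (ψ γ).1 = blockTrace (ψ η).1 ↔ IsConj γ η) {γ η : Γ}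
    (h : ¬ IsConj γ η) : ∃ j k, blockTrace (ψ γ).1 j k ≠ blockTrace (ψ η).1 j k := by
  by_contra! h'
  exact h ((hψ γ η).1 (Matrix.ext h'))

/-- Two classes are separated modulo almost all primes. -/
lemma finite_setOf_not_separates (hg : g ≠ 0)
    (hψ : ∀ γ η, blockTrace (ψ γ).1 = blockTrace (ψ η).1 ↔ IsConj γ η)
    {c₁ c₂ : ConjClasses Γ} (hc : c₁ ≠ c₂) :
    {p ∈ {p : ℕ | p.Prime} | ¬ ∃ (Q : Subgroup SL(n * m, ZMod p)) (φ : Γ →* Q),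
      Function.Surjective φ ∧ Separates φ c₁ c₂}.Finite := by
  obtain ⟨γ, rfl⟩ := ConjClasses.exists_rep c₁
  obtain ⟨η, rfl⟩ := ConjClasses.exists_rep c₂
  obtain ⟨j, k, hjk⟩ := exists_blockTrace_apply_ne hψ
    fun h => hc (ConjClasses.mk_eq_mk_iff_isConj.2 h)
  obtain ⟨h, ⟨b, hb⟩, hh⟩ := IsLocalization.exists_mk'_eq (Submonoid.powers g)
    (blockTrace (ψ γ).1 j k - blockTrace (ψ η).1 j k)
  rw [IsLocalization.mk'_eq_iff_eq_mul] at hh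
  have h0 : h ≠ 0 := by
    rintro rfl
    rw [map_zero] at hh
    exact hjk (sub_eq_zero.1 (((IsLocalization.map_units _
      (⟨b, hb⟩ : Submonoid.powers g)).mul_left_eq_zero).1 hh.symm))
  obtain ⟨a, -, ha⟩ := MvPolynomial.exists_abs_le_eval_ne_zero (mul_ne_zero h0 hg) le_rfl
  refine (Nat.divisors (MvPolynomial.eval a (h * g)).natAbs).finite_toSet.subset fun p hp => ?_
  by_contra hpd
  refine hp.2 (exists_separates_of_not_dvd_eval ψ (fun γ η => (hψ γ η).2)
    (hh.trans (mul_comm _ _)) hp.1 a fun hd => hpd ?_)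
  exact Nat.mem_divisors.2 ⟨Int.natCast_dvd.1 hd, Int.natAbs_ne_zero.2 ha⟩

/-- Two classes of length at most `N` are separated modulo a prime of size `O(N ^ 4)`. -/
lemma exists_prime_le_separates (hg : g ≠ 0)
    (hψ : ∀ γ η, blockTrace (ψ γ).1 = blockTrace (ψ η).1 ↔ IsConj γ η)
    {X : Set Γ} (hX : IsFiniteGeneratingSet X) :
    ∃ C : ℕ, 0 < C ∧ ∀ N : ℕ, ∀ c₁ ∈ classBall X N, ∀ c₂ ∈ classBall X N, c₁ ≠ c₂ →
      ∃ p : ℕ, p.Prime ∧ p ≤ C * N ^ 4 ∧ ∃ (Q : Subgroup SL(n * m, ZMod p)) (φ : Γ →* Q),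
        Function.Surjective φ ∧ Separates φ c₁ c₂ := by
  classical
  -- The letter 1 pads words to length exactly N, so both classes get the same denominator `b ^ N`.
  let Y : Set Γ := insert 1 (X ∪ {x | x⁻¹ ∈ X})
  have hY : Finite Y := by
    refine Set.Finite.insert _ (hX.1.union ?_)
    exact hX.1.preimage inv_injective.injOn
  obtain ⟨b, hb⟩ := IsLocalization.exist_integer_multiples_of_finite (Submonoid.powers g)
    (fun x : Y × (Fin n × Fin m) × (Fin n × Fin m) => (ψ x.1).1 x.2.1 x.2.2)
  choose P hP using hb
  let PM : Γ → Matrix (Fin n × Fin m) (Fin n × Fin m) (MvPolynomial ι ℤ) := fun y =>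
    if hy : y ∈ Y then Matrix.of fun i j => P (⟨y, hy⟩, i, j) else 0
  obtain ⟨c, hc⟩ := MvPolynomial.exists_forall_expBounded P
  obtain ⟨cg, hcg⟩ := MvPolynomial.exists_expBounded g
  have hPM : ∀ y ∈ Y, (algebraMap _ (Localization.Away g)).mapMatrix (PM y) =
      algebraMap _ (Localization.Away g) (b : MvPolynomial ι ℤ) • (ψ y).1 := fun y hy => by
    ext i j
    simp only [PM, hy, dif_pos, RingHom.mapMatrix_apply, Matrix.map_apply, Matrix.of_apply,
      Matrix.smul_apply]
    rw [hP, Algebra.smul_def, smul_eq_mul]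
  have hprod : ∀ w : List Γ, (∀ x ∈ w, x ∈ Y) →
      (algebraMap _ (Localization.Away g)).mapMatrix (w.map PM).prod =
        algebraMap _ (Localization.Away g) (b : MvPolynomial ι ℤ) ^ w.length •
          (ψ w.prod).1 := fun w hw => by
    induction w with
    | nil => simp
    | cons y w ih =>
      rw [List.map_cons, List.prod_cons, map_mul, hPM y (hw y (by simp)),
        ih fun x hx => hw x (by simp [hx]), List.prod_cons, map_mul, List.length_cons, pow_succ',
        smul_mul_smul_comm]
      rfl
  have hbound : ∀ w : List Γ, (∀ x ∈ w, x ∈ Y) → ∀ i j, MvPolynomial.ExpBounded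
      (w.length * (n * m + c)) ((w.map PM).prod i j) := fun w hw i j => by
    have := MvPolynomial.ExpBounded.list_prod (c := c) (w.map PM) (fun M hM i j => by
      obtain ⟨y, hy, rfl⟩ := List.mem_map.1 hM
      simp only [PM, hw y hy, dif_pos, Matrix.of_apply]
      exact hc _) i j
    simpa using this
  have hword : ∀ N : ℕ, ∀ c ∈ classBall X N, ∃ w : List Γ, (∀ x ∈ w, x ∈ Y) ∧ w.length = N ∧
      ConjClasses.mk w.prod = c := fun N c hcN => by
    obtain ⟨w, hw, hwN, rfl⟩ := exists_word_of_mem_classBall hX hcN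
    refine ⟨w ++ List.replicate (N - w.length) 1, fun x hx => ?_, ?_, ?_⟩
    · rcases List.mem_append.1 hx with hx | hx
      · exact Or.inr (hw x hx)
      · exact Or.inl (List.eq_of_mem_replicate hx)
    · simp [hwN]
    · simp
  -- The terms come from the product (nm + c per letter), the block sum (n), the difference (2) and
  -- the factor g (cg).
  let D := n * m + c + n + 2 + cg
  refine ⟨(20 * (D + 1) ^ 2) ^ 2, by positivity, fun N c₁ h₁ c₂ h₂ hne => ?_⟩
  obtain ⟨w, hw, hwN, rfl⟩ := hword N c₁ h₁
  obtain ⟨v, hv, hvN, rfl⟩ := hword N c₂ h₂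
  have hN : 1 ≤ N := by
    by_contra hN
    obtain rfl : N = 0 := by omega
    rw [List.length_eq_zero_iff] at hwN hvN
    exact hne (by rw [hwN, hvN])
  obtain ⟨j, k, hjk⟩ := exists_blockTrace_apply_ne hψ
    fun h => hne (ConjClasses.mk_eq_mk_iff_isConj.2 h)
  let h : MvPolynomial ι ℤ :=
    blockTrace (w.map PM).prod j k + -blockTrace (v.map PM).prod j k
  have htr : ∀ u : List Γ, (∀ x ∈ u, x ∈ Y) → u.length = N →
      algebraMap _ (Localization.Away g) (blockTrace (u.map PM).prod j k) =
        algebraMap _ (Localization.Away g) (b : MvPolynomial ι ℤ) ^ N *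
          blockTrace (ψ u.prod).1 j k := fun u hu huN => by
    have := congrArg (fun M => blockTrace M j k) (hprod u hu)
    simp only [RingHom.mapMatrix_apply, blockTrace_map, Matrix.map_apply] at this
    rw [this, huN, blockTrace_apply, blockTrace_apply, Finset.mul_sum]
    rfl
  have hh : algebraMap _ (Localization.Away g) h =
      algebraMap _ (Localization.Away g) (b : MvPolynomial ι ℤ) ^ N *
        (blockTrace (ψ w.prod).1 j k - blockTrace (ψ v.prod).1 j k) := by
    rw [map_add, map_neg, htr w hw hwN, htr v hv hvN]
    ring
  have h0 : h ≠ 0 := fun h0 => by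
    rw [h0, map_zero] at hh
    exact hjk (sub_eq_zero.1 ((((IsLocalization.map_units _ b).pow N).mul_right_eq_zero).1 hh.symm))
  have htrB : ∀ u : List Γ, (∀ x ∈ u, x ∈ Y) → u.length = N → MvPolynomial.ExpBounded
      (n + N * (n * m + c)) (blockTrace (u.map PM).prod j k) := fun u hu huN => by
    rw [blockTrace_apply]
    have := MvPolynomial.ExpBounded.sum (Finset.univ : Finset (Fin n)) fun i _ =>
      huN ▸ hbound u hu (i, j) (i, k)
    rwa [Finset.card_fin] at this
  have hB : MvPolynomial.ExpBounded ((D + 1) * N) (h * g) := by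
    refine (((htrB w hw hwN).add (htrB v hv hvN).neg).mul hcg).mono ?_
    simp only [D]
    nlinarith
  obtain ⟨a, ha, hne0⟩ := MvPolynomial.exists_abs_le_eval_ne_zero (mul_ne_zero h0 hg) hB.1
  have hDN : 1 ≤ (D + 1) * N := Nat.mul_pos (Nat.succ_pos _) hN
  have hT := hB.2 _ hDN a ha
  -- The box size equals the degree bound (D + 1)N, whence its square in the exponent.
  obtain ⟨p, hp, hpM, hpT⟩ := Nat.exists_prime_le_not_dvd
    (T := (MvPolynomial.eval a (h * g)).natAbs) (M := (D + 1) * N * ((D + 1) * N))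
    (Int.natAbs_ne_zero.2 hne0) (by rw [Int.abs_eq_natAbs] at hT; exact_mod_cast hT)
  refine ⟨p, hp, hpM.trans ?_, exists_separates_of_not_dvd_eval ψ (fun γ η => (hψ γ η).2) hh hp a
    fun hd => hpT (Int.natCast_dvd.1 hd)⟩
  calc (4 * ((D + 1) * N * ((D + 1) * N) + 4)) ^ 2 ≤ (20 * (D + 1) ^ 2 * N ^ 2) ^ 2 := by
        refine Nat.pow_le_pow_left ?_ 2
        nlinarith [Nat.mul_le_mul hDN hDN]
    _ = (20 * (D + 1) ^ 2) ^ 2 * N ^ 4 := by ring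

end Model

end ConjSep

theorem theorem1p5 {Γ : Type*} [Group Γ] [Group.FG Γ] (hA : ConjSep.PropertyA Γ) :
    ∃ d : ℕ,
      -- `Conj_Γ(n) ≼ n ^ d`, for every choice of the finite generating set
      (∀ X : Set Γ, ConjSep.IsFiniteGeneratingSet X →
        ConjSep.AsympLE (ConjSep.conjComplexity X) (fun n => (n : ℕ∞) ^ d)) ∧
      -- the quotients used are subgroups `Q` of `SL(n₀, 𝔽_p)`, `p` in an infinite set `P` of primes
      ∃ (n₀ : ℕ) (P : Set ℕ), P.Infinite ∧ (∀ p ∈ P, p.Prime) ∧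
        -- such quotients realize the polynomial bound
        (∀ X : Set Γ, ConjSep.IsFiniteGeneratingSet X →
          ∃ C : ℕ, 0 < C ∧ ∀ n : ℕ, ∀ c₁ ∈ ConjSep.classBall X n, ∀ c₂ ∈ ConjSep.classBall X n,
            c₁ ≠ c₂ →
            ∃ p ∈ P, ∃ (Q : Subgroup SL(n₀, ZMod p)) (φ : Γ →* Q),
              Function.Surjective φ ∧ ConjSep.Separates φ c₁ c₂ ∧ Nat.card Q ≤ C * (C * n) ^ d) ∧
        -- any two classes are separated in this way for all but finitely many `p` in `P`
        (∀ c₁ c₂ : ConjClasses Γ, c₁ ≠ c₂ →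
          {p ∈ P | ¬ ∃ (Q : Subgroup SL(n₀, ZMod p)) (φ : Γ →* Q),
            Function.Surjective φ ∧ ConjSep.Separates φ c₁ c₂}.Finite) := by
  obtain ⟨n, ρ, hρ⟩ := hA
  obtain ⟨s, _, _, _⟩ := exists_isAlgebraic_mvPolynomial_int ℂ
  obtain ⟨m, g, ψ, hg, hψ'⟩ := exists_blockTrace_model (R := MvPolynomial s ℤ) ρ
  have hψ : ∀ γ η, blockTrace (ψ γ).1 = blockTrace (ψ η).1 ↔ IsConj γ η := fun γ η => by
    refine (hψ' γ η).trans ⟨fun h => ?_, fun h => ?_⟩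
    · by_contra hc
      exact hρ γ η hc h
    · obtain ⟨δ, rfl⟩ := isConj_iff.1 h
      have h1 : (ρ γ).1 * (ρ δ⁻¹).1 * (ρ δ).1 = (ρ γ).1 :=
        congrArg Subtype.val (show ρ γ * ρ δ⁻¹ * ρ δ = ρ γ by
          rw [mul_assoc, ← map_mul, inv_mul_cancel, map_one, mul_one])
      have h2 : (ρ (δ * γ * δ⁻¹)).1 = (ρ δ).1 * ((ρ γ).1 * (ρ δ⁻¹).1) :=
        congrArg Subtype.val (show ρ (δ * γ * δ⁻¹) = ρ δ * (ρ γ * ρ δ⁻¹) by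
          rw [mul_assoc, map_mul, map_mul])
      rw [h2, trace_mul_comm, h1]
  -- The prime is O(N⁴), and a matrix has (nm)² entries.
  set d := 4 * (n * m * (n * m)) with hd
  have key : ∀ X : Set Γ, ConjSep.IsFiniteGeneratingSet X →
      ∃ C : ℕ, 0 < C ∧ ∀ N : ℕ, ∀ c₁ ∈ ConjSep.classBall X N, ∀ c₂ ∈ ConjSep.classBall X N,
        c₁ ≠ c₂ → ∃ p ∈ {p : ℕ | p.Prime}, ∃ (Q : Subgroup SL(n * m, ZMod p)) (φ : Γ →* Q),
          Function.Surjective φ ∧ ConjSep.Separates φ c₁ c₂ ∧ Nat.card Q ≤ C * (C * N) ^ d := by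
    intro X hX
    obtain ⟨C, hC, h⟩ := ConjSep.exists_prime_le_separates hg hψ hX
    refine ⟨C ^ (n * m * (n * m)), by positivity, fun N c₁ h₁ c₂ h₂ hne => ?_⟩
    obtain ⟨p, hp, hpN, Q, φ, hφ, hsep⟩ := h N c₁ h₁ c₂ h₂ hne
    have : NeZero p := ⟨hp.ne_zero⟩
    refine ⟨p, hp, Q, φ, hφ, hsep, ?_⟩
    calc Nat.card Q ≤ Nat.card SL(n * m, ZMod p) := Subgroup.card_le_card_group Q
      _ ≤ p ^ (n * m * (n * m)) := SpecialLinearGroup.card_zmod_le _ _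
      _ ≤ (C * N ^ 4) ^ (n * m * (n * m)) := by gcongr
      _ = C ^ (n * m * (n * m)) * N ^ d := by rw [mul_pow, ← pow_mul]
      _ ≤ C ^ (n * m * (n * m)) * (C ^ (n * m * (n * m)) * N) ^ d := by
        gcongr
        exact Nat.le_mul_of_pos_left _ (by positivity)
  refine ⟨d, fun X hX => ?_, n * m, {p | p.Prime}, Nat.infinite_setOfPred_prime, fun p hp => hp, key,
    fun c₁ c₂ hc => ConjSep.finite_setOf_not_separates hg hψ hc⟩
  obtain ⟨C, hC, h⟩ := key X hX
  refine ⟨C, hC, fun N => sSup_le ?_⟩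
  rintro _ ⟨c₁, h₁, c₂, h₂, hne, rfl⟩
  obtain ⟨p, hp, Q, φ, -, hsep, hcard⟩ := h N c₁ h₁ c₂ h₂ hne
  have : NeZero p := ⟨Nat.Prime.ne_zero hp⟩
  calc ConjSep.con c₁ c₂ ≤ (Nat.card Q : ℕ∞) :=
        sInf_le ⟨Q, inferInstance, inferInstance, φ, hsep, rfl⟩
    _ ≤ ((C * (C * N) ^ d : ℕ) : ℕ∞) := by exact_mod_cast hcard
    _ = _ := by push_cast; rfl
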